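/- Let $R$ be an $h$-local domain, i.e. a commutative domain in which every non-zero element lies in only finitely many maximal ideals and every non-zero prime ideal is contained in a unique maximal ideal. Let $\mathfrak m_1\neq\mathfrak m_2$ be maximal ideals of $R$. For $i=1,2$, let $M_i$ be a finitely generated, indecomposable (in particular non-zero), torsion-free $R_{\mathfrak m_i}$-module whose endomorphism ring is local, and let $r_i$ be its rank, that is, the dimension of $M_i\otimes_{R_{\mathfrak m_i}} Q$ over the field of fractions $Q$ of $R_{\mathfrak m_i}$. Then: (1) For $i=1,2$ there exists a finitely generated, indecomposable, torsion-free $R$-module $X_i$ such that $(X_i)_{\mathfrak m_i}\cong M_i$ as $R_{\mathfrak m_i}$-modules and $(X_i)_{\mathfrak n}\cong R_{\mathfrak n}^{\,r_i}$ for every maximal ideal $\mathfrak n\neq\mathfrak m_i$ of $R$. (2) If $\gcd(r_1,r_2)\neq 1$, then, for any modules $X_1,X_2$ as in (1), the class $\operatorname{Add}(X_1\oplus X_2)$ (of all modules isomorphic to a direct summand of a direct sum, over an arbitrary index set, of copies of $X_1\oplus X_2$) contains an $R$-module that is not a direct sum of finitely generated modules. -/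

import Mathlib

open scoped TensorProduct

universe u v w

/-- A commutative ring is an `h`-local domain if it is a domain, every nonzero element lies in only
finitely many maximal ideals, and every nonzero prime ideal lies in a unique maximal ideal. -/
structure IsHLocalDomain (R : Type u) [CommRing R] : Prop where
  isDomain : IsDomain R
  finite_character : ∀ a : R, a ≠ 0 → {m : Ideal R | m.IsMaximal ∧ a ∈ m}.Finite
  existsUnique_maximal : ∀ p : Ideal R, p.IsPrime → p ≠ ⊥ → ∃! m : Ideal R, m.IsMaximal ∧ p ≤ m

/-- A module is indecomposable if it is nonzero and is not the internal direct sum of two nonzero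
submodules. -/
structure IsIndecomposableModule (A : Type u) [Ring A] (M : Type v) [AddCommGroup M] [Module A M] :
    Prop where
  nontrivial : Nontrivial M
  eq_bot_or_eq_bot : ∀ N P : Submodule A M, IsCompl N P → N = ⊥ ∨ P = ⊥

/-- The rank of a finitely generated module `M` over a domain `A` with field of fractions `Q`:
the dimension of the `Q`-vector space `Q ⊗ M`. -/
noncomputable def moduleRank (A : Type u) [CommRing A] (M : Type v) [AddCommGroup M]
    [Module A M] : ℕ :=
  Module.finrank (FractionRing A) (FractionRing A ⊗[A] M)

/-- `L` belongs to `Add(M)`: it is isomorphic to a direct summand of a direct sum of copies of `M`.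
(Index types in the universe of `L` suffice, since the image of `L` in a direct sum of copies of
`M` involves at most `max (#L) ℵ₀` of the copies.) -/
def MemAdd (A : Type u) [Ring A] (M : Type v) [AddCommGroup M] [Module A M]
    (L : Type w) [AddCommGroup L] [Module A L] : Prop :=
  ∃ (ι : Type w) (N P : Submodule A (ι →₀ M)), IsCompl N P ∧ Nonempty (L ≃ₗ[A] N)

open Classical in
/-- `L` is the (internal) direct sum of a family of finitely generated submodules.
(Index types in the universe of `L` suffice, since zero summands may be dropped.) -/
def IsDirectSumOfFG (A : Type u) [Ring A] (L : Type w) [AddCommGroup L] [Module A L] : Prop :=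
  ∃ (ι : Type w) (N : ι → Submodule A L), (∀ i, (N i).FG) ∧ DirectSum.IsInternal N

/-- `X` is a finitely generated indecomposable torsion-free `R`-module whose localization at the
maximal ideal `m` is isomorphic to the given `R_m`-module `M`, and whose localization at every other
maximal ideal `n` is isomorphic to `R_n ^ r`, where `r` is the rank of `M`. -/
structure IsGlobalForm (R : Type u) [CommRing R] (m : Ideal R) [m.IsMaximal]
    (M : Type v) [AddCommGroup M] [Module (Localization.AtPrime m) M]
    (X : Type w) [AddCommGroup X] [Module R X] : Prop where
  finite : Module.Finite R X
  indecomposable : IsIndecomposableModule R X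
  torsionFree : Module.IsTorsionFree R X
  localization_equiv :
    Nonempty (LocalizedModule m.primeCompl X ≃ₗ[Localization.AtPrime m] M)
  localization_free : ∀ (n : Ideal R) [n.IsMaximal], n ≠ m →
    Nonempty (LocalizedModule n.primeCompl X ≃ₗ[Localization.AtPrime n]
      (Fin (moduleRank (Localization.AtPrime m) M) → Localization.AtPrime n))

/-!
Let `R` be an `h`-local domain. Since no nonzero prime ideal lies in two maximal ideals, and a
nonzero scalar `s` lies in finitely many of them, there is for every maximal ideal `m` an element
`e ∉ m` that `s` divides locally at all other maximal ideals
(`IsHLocalDomain.exists_notMem_forall_dvd_mul`).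

*Global forms.* A finitely generated torsion-free `R_m`-module `M` of rank `r` is isomorphic to
a lattice between `s R_m ^ r` and `R_m ^ r`. Choosing generators in `R ^ r`, the submodule
`X = s R ^ r + e (generators)` of `R ^ r` localizes to `M` at `m`, and agrees with `s R ^ r` locally
at every other maximal ideal (`IsHLocalDomain.exists_submodule_pi`). It is indecomposable because
`M` is.

*The module that is not a direct sum of finitely generated ones.* Let `Y ≤ R ^ r₁` and `Z ≤ R ^ r₂`
be such lattices for `M₁` and `M₂`, with the same `s`. The modules `P = R ⊕ Y ^ (ℕ)` and
`G = Z ^ (ℕ)` embed into one free module `V` of countable rank, both images containing `s V`; let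
`L` be the sum of the two images (`exists_amalgam`). The set of scalars `b` with `b Z ≤ s R ^ r₂` is
an ideal contained in no maximal ideal except possibly `m₂`, and the scalars `a` with
`a Y ≤ s R ^ r₁` form an ideal contained in none except possibly `m₁`. So there are such `a` and `b`
with `a + b = 1`. Since `b L` lies in the image of `P` and `a L` in that of `G`, the map
`x ↦ (b x, a x)` splits `L` off `P ⊕ G`. Being in `add` of a finitely generated torsion-free module
is a local property of finitely generated torsion-free modules
(`one_mem_factoringEnd_of_forall_isMaximal`, `exists_smul_one_mem_factoringEnd`), so `R`, `Y` and
`Z` are direct summands of finite direct sums of copies of `X₁ ⊕ X₂`, and `L` lies in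
`Add (X₁ ⊕ X₂)`.

Suppose that `L` is a direct sum of finitely generated modules. As `L` agrees with `G` at `m₂`,
each summand localizes at `m₂` to a direct summand of some `M₂ ^ k`, and the exchange property of
modules with local endomorphism rings (`exists_equiv_prod_of_isLocalRing_end`) shows that its rank
is a multiple of `r₂`. As `L` agrees with `P` at `m₁`, the summand `R` of `P` splits, locally at
`m₁`, off one of the summands of `L`; that one is locally a direct summand of some `R ⊕ M₁ ^ k`, and
by cancellation its rank is `1` modulo `r₁` (`exists_finrank_eq_one_add_mul`). Hence `r₁` and `r₂`
are coprime.
-/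

/-! ### Ranks over a domain -/

theorem moduleRank_eq_finrank (A : Type u) [CommRing A] [IsDomain A] (M : Type v) [AddCommGroup M]
    [Module A M] : moduleRank A M = Module.finrank A M := by
  have : IsLocalizedModule (nonZeroDivisors A) (TensorProduct.mk A (FractionRing A) M 1) :=
    (isLocalizedModule_iff_isBaseChange (nonZeroDivisors A) (FractionRing A) _).mpr
      (TensorProduct.isBaseChange A M (FractionRing A))
  rw [moduleRank, IsLocalization.finrank_eq (FractionRing A) (nonZeroDivisors A) le_rfl,
    IsLocalizedModule.finrank_eq (nonZeroDivisors A) (TensorProduct.mk A (FractionRing A) M 1)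
      le_rfl]

/-- Unlike `Module.finrank_prod`, no freeness is assumed. -/
theorem finrank_prod_of_isDomain {A : Type u} [CommRing A] [IsDomain A] {M : Type v} {N : Type w}
    [AddCommGroup M] [Module A M] [AddCommGroup N] [Module A N] [Module.Finite A M]
    [Module.Finite A N] :
    Module.finrank A (M × N) = Module.finrank A M + Module.finrank A N := by
  have h := Submodule.finrank_quotient_add_finrank (LinearMap.ker (LinearMap.fst A M N))
  have h1 := ((LinearMap.fst A M N).quotKerEquivOfSurjective LinearMap.fst_surjective).finrank_eq
  have h2 : Module.finrank A (LinearMap.ker (LinearMap.fst A M N)) = Module.finrank A N := by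
    rw [LinearMap.ker_fst]
    exact LinearMap.finrank_range_of_inj LinearMap.inr_injective
  omega

/-! ### Cancellation of modules with local endomorphism rings -/

/-- Let `e : N ⊕ P ≅ M ⊕ K`. If the component `N → M` of `e` has a right inverse up to an
automorphism of `M`, then `M` splits off `N`, and it can be cancelled: the kernel `N'` of that
component satisfies `N' ⊕ P ≅ K`. -/
theorem exists_equiv_prod_of_isUnit {A : Type u} [Ring A] {M K : Type*} {N P : Type*}
    [AddCommGroup M] [Module A M] [AddCommGroup K] [Module A K] [AddCommGroup N] [Module A N]
    [AddCommGroup P] [Module A P] (e : (N × P) ≃ₗ[A] M × K) (p : M →ₗ[A] N)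
    (h : IsUnit (LinearMap.fst A M K ∘ₗ e.toLinearMap ∘ₗ LinearMap.inl A N P ∘ₗ p :
      Module.End A M)) :
    ∃ N' : Submodule A N, Nonempty (N ≃ₗ[A] M × N') ∧ Nonempty ((N' × P) ≃ₗ[A] K) := by
  set g : N →ₗ[A] M := LinearMap.fst A M K ∘ₗ e.toLinearMap ∘ₗ LinearMap.inl A N P with hg
  obtain ⟨⟨c, d, hcd, hdc⟩, rfl : c = _⟩ := h
  -- `u` is a section of `g`, so its image in `N × P` has the complements `ker g × P` and
  -- `e⁻¹ (0 × K)`, which are therefore isomorphic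
  set u : M →ₗ[A] N := p ∘ₗ d with hu
  have hgu : ∀ x, g (u x) = x := fun x ↦ by
    simpa [hg, hu] using LinearMap.congr_fun hcd x
  have hge : ∀ n y, (e (n, y)).1 = g n + (e (0, y)).1 := fun n y ↦ by
    have : ((n, y) : N × P) = (n, 0) + (0, y) := by simp
    rw [this, map_add]
    simp [hg]
  refine ⟨LinearMap.ker g, ⟨?_⟩, ⟨?_⟩⟩
  · refine LinearEquiv.ofLinearMap
      (g.prod ((LinearMap.id - u ∘ₗ g).codRestrict (LinearMap.ker g) fun x ↦ by simp [hgu]))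
      (u.coprod (LinearMap.ker g).subtype) ?_ ?_
    · refine LinearMap.ext fun x ↦ Prod.ext ?_ (Subtype.ext ?_)
      · simp [hgu]
      · simp [hgu]
    · ext x
      simp
  · refine LinearEquiv.ofLinearMap
      (LinearMap.snd A M K ∘ₗ e.toLinearMap ∘ₗ
        (((LinearMap.ker g).subtype ∘ₗ LinearMap.fst A _ P) - u ∘ₗ LinearMap.fst A M K ∘ₗ
          e.toLinearMap ∘ₗ LinearMap.inr A N P ∘ₗ LinearMap.snd A _ P).prod (LinearMap.snd A _ P))
      ((((LinearMap.id - u ∘ₗ g).codRestrict (LinearMap.ker g) fun x ↦ by simp [hgu]).prodMap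
        LinearMap.id) ∘ₗ e.symm.toLinearMap ∘ₗ LinearMap.inr A M K) ?_ ?_
    · refine LinearMap.ext fun k ↦ ?_
      obtain ⟨⟨n, y⟩, hn⟩ : ∃ z, e z = (0, k) := ⟨e.symm (0, k), by simp⟩
      have hn' : e.symm (0, k) = (n, y) := by rw [← hn]; simp
      have h0 : g n + (e (0, y)).1 = 0 := by rw [← hge, hn]
      have h1 : n - u (g n) - u (e (0, y)).1 = n := by
        rw [sub_sub, ← map_add, h0]; simp
      simp [hn', h1, hn]
    · refine LinearMap.ext fun ⟨n, y⟩ ↦ ?_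
      have hn : g n = 0 := n.2
      set z : N × P := ((n : N) - u (e (0, y)).1, y) with hz
      have h1 : (e z).1 = 0 := by rw [hz, hge, map_sub, hgu, hn]; simp
      have h2 : e.symm (0, (e z).2) = z := by
        rw [LinearEquiv.symm_apply_eq]; exact Prod.ext h1.symm rfl
      refine Prod.ext (Subtype.ext ?_) ?_
      · simp [h2, ← hz]
        simp [hz, hn, hgu]
      · simp [h2, ← hz]
        simp [hz]

/-- A module `M` with local endomorphism ring has the exchange property: if `N ⊕ P ≅ M ⊕ K`, then
`M` splits off `N` or off `P`, and it can be cancelled. -/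
theorem exists_equiv_prod_of_isLocalRing_end {A : Type u} [Ring A] {M K : Type*} {N P : Type*}
    [AddCommGroup M] [Module A M] [AddCommGroup K] [Module A K] [AddCommGroup N] [Module A N]
    [AddCommGroup P] [Module A P] [IsLocalRing (Module.End A M)] (e : (N × P) ≃ₗ[A] M × K) :
    (∃ N' : Submodule A N, Nonempty (N ≃ₗ[A] M × N') ∧ Nonempty ((N' × P) ≃ₗ[A] K)) ∨
    (∃ P' : Submodule A P, Nonempty (P ≃ₗ[A] M × P') ∧ Nonempty ((N × P') ≃ₗ[A] K)) := by
  set p : M →ₗ[A] N := LinearMap.fst A N P ∘ₗ e.symm.toLinearMap ∘ₗ LinearMap.inl A M K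
  set q : M →ₗ[A] P := LinearMap.snd A N P ∘ₗ e.symm.toLinearMap ∘ₗ LinearMap.inl A M K
  have key : (LinearMap.fst A M K ∘ₗ e.toLinearMap ∘ₗ LinearMap.inl A N P ∘ₗ p : Module.End A M) +
      (LinearMap.fst A M K ∘ₗ e.toLinearMap ∘ₗ LinearMap.inr A N P ∘ₗ q : Module.End A M) = 1 := by
    refine LinearMap.ext fun x ↦ ?_
    have h : ((p x, 0) : N × P) + (0, q x) = e.symm (x, 0) := by
      simp [p, q]
    have h2 := congrArg (fun z ↦ (e z).1) h
    simpa only [map_add, LinearEquiv.apply_symm_apply] using! h2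
  rcases IsLocalRing.isUnit_or_isUnit_of_add_one key with h | h
  · exact Or.inl (exists_equiv_prod_of_isUnit e p h)
  · obtain ⟨P', h1, ⟨h2⟩⟩ :=
      exists_equiv_prod_of_isUnit ((LinearEquiv.prodComm A P N).trans e) q h
    exact Or.inr ⟨P', h1, ⟨(LinearEquiv.prodComm A N P').trans h2⟩⟩

theorem Module.Finite.of_prod_equiv_pi {A : Type*} [Ring A] {M : Type*}
    [AddCommGroup M] [Module A M] [Module.Finite A M] {k : ℕ}
    {N P : Type*} [AddCommGroup N] [Module A N] [AddCommGroup P] [Module A P]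
    (e : (N × P) ≃ₗ[A] (Fin k → M)) : Module.Finite A N :=
  Module.Finite.of_surjective (LinearMap.fst A N P ∘ₗ e.symm.toLinearMap)
    fun n ↦ ⟨e (n, 0), by simp⟩

/-- A weak form of the Krull–Schmidt theorem, recording ranks only. -/
theorem finrank_dvd_of_prod_equiv_pi {A : Type u} [CommRing A] [IsDomain A] {M : Type v}
    [AddCommGroup M] [Module A M] [Module.Finite A M] [IsLocalRing (Module.End A M)] (k : ℕ)
    {N P : Type*} [AddCommGroup N] [Module A N] [AddCommGroup P] [Module A P]
    (e : (N × P) ≃ₗ[A] (Fin k → M)) : Module.finrank A M ∣ Module.finrank A N := by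
  induction k generalizing N P with
  | zero =>
    have : Subsingleton (N × P) := e.injective.subsingleton
    have : Subsingleton N :=
      Function.Injective.subsingleton (LinearMap.inl_injective (R := A) (M := N) (M₂ := P))
    rw [Module.finrank_zero_of_subsingleton (R := A) (M := N)]
    exact dvd_zero _
  | succ k ih =>
    have hN := Module.Finite.of_prod_equiv_pi e
    rcases exists_equiv_prod_of_isLocalRing_end (e.trans (Fin.consLinearEquiv A fun _ ↦ M).symm)
      with ⟨N', ⟨e₁⟩, ⟨e₂⟩⟩ | ⟨P', -, ⟨e₂⟩⟩
    · have hN' := Module.Finite.of_prod_equiv_pi e₂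
      rw [e₁.finrank_eq, finrank_prod_of_isDomain]
      exact dvd_add dvd_rfl (ih e₂)
    · exact ih e₂

/-- Over a local domain `A`, let `M` have local endomorphism ring, let `N` be a direct summand of
`A ⊕ M ^ k`, and write `N ≅ A ⊕ N'` by means of the surjection `f`. Cancelling `A` shows that `N'`
is a direct summand of `M ^ k`, up to a summand of rank zero. -/
theorem exists_finrank_eq_one_add_mul {A : Type u} [CommRing A] [IsDomain A] [IsLocalRing A]
    {M : Type v} [AddCommGroup M] [Module A M] [Module.Finite A M] [IsLocalRing (Module.End A M)]
    {k : ℕ} {N P : Type*} [AddCommGroup N] [Module A N] [AddCommGroup P] [Module A P]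
    (e : (N × P) ≃ₗ[A] A × (Fin k → M)) {y : N} {f : N →ₗ[A] A} (hy : f y = 1) :
    ∃ c, Module.finrank A N = 1 + Module.finrank A M * c := by
  have hN : Module.Finite A N := Module.Finite.of_surjective
    (LinearMap.fst A N P ∘ₗ e.symm.toLinearMap) fun n ↦ ⟨e (n, 0), by simp⟩
  have : IsLocalRing (Module.End A A) := by
    have : IsLocalRing Aᵐᵒᵖ := (RingEquiv.toOpposite A).isLocalRing
    exact (RingEquiv.moduleEndSelf A).isLocalRing
  set K := LinearMap.ker f
  have eN : N ≃ₗ[A] A × K := LinearEquiv.ofLinearMap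
    (f.prod ((LinearMap.id - (LinearMap.toSpanSingleton A N y) ∘ₗ f).codRestrict K
      fun x ↦ by simp [K, hy]))
    ((LinearMap.toSpanSingleton A N y).coprod K.subtype)
    (by
      refine LinearMap.ext fun ⟨a, x⟩ ↦ Prod.ext ?_ (Subtype.ext ?_)
      · have : f x = 0 := x.2
        simp [hy, this]
      · have : f x = 0 := x.2
        simp [hy, this])
    (by ext x; simp)
  have hK : Module.Finite A K := Module.Finite.of_surjective
    (LinearMap.snd A A K ∘ₗ eN.toLinearMap) fun n ↦ ⟨eN.symm (0, n), by simp⟩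
  rw [eN.finrank_eq, finrank_prod_of_isDomain, Module.finrank_self]
  suffices Module.finrank A M ∣ Module.finrank A K from
    this.imp fun c hc ↦ by rw [hc]
  have e' : (A × (K × P)) ≃ₗ[A] A × (Fin k → M) :=
    (LinearEquiv.prodAssoc A A K P).symm.trans
      (((eN.symm.prodCongr (LinearEquiv.refl A P))).trans e)
  rcases exists_equiv_prod_of_isLocalRing_end e' with ⟨N', ⟨e₁⟩, ⟨e₂⟩⟩ | ⟨P', ⟨e₁⟩, ⟨e₂⟩⟩
  · have hN' : Module.Finite A N' := Module.Finite.of_prod_equiv_pi e₂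
    have h0 : Module.finrank A N' = 0 := by
      have := e₁.finrank_eq
      rw [finrank_prod_of_isDomain, Module.finrank_self] at this
      omega
    have := finrank_dvd_of_prod_equiv_pi k ((LinearEquiv.prodAssoc A N' K P).trans e₂)
    rwa [finrank_prod_of_isDomain, h0, zero_add] at this
  · exact finrank_dvd_of_prod_equiv_pi k (e₁.trans e₂)

/-! ### Separating maximal ideals in an `h`-local domain -/

section HLocal

variable {R : Type u} [CommRing R]

/-- Since no nonzero prime is contained in both `m` and `n`, a nonzero `s` becomes invertible when
the complements of `m` and of `n` are inverted simultaneously. -/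
theorem IsHLocalDomain.exists_dvd_mul (hR : IsHLocalDomain R) {m n : Ideal R} [m.IsMaximal]
    [n.IsMaximal] (hmn : m ≠ n) {s : R} (hs : s ≠ 0) : ∃ t ∉ m, ∃ u ∉ n, s ∣ t * u := by
  by_contra! h
  have hdisj : Disjoint (Ideal.span {s} : Set R)
      ((m.primeCompl ⊔ n.primeCompl : Submonoid R) : Set R) := by
    rw [Set.disjoint_left]
    intro x hx hx'
    obtain ⟨t, ht, u, hu, rfl⟩ := Submonoid.mem_sup.mp hx'
    exact h t ht u hu (Ideal.mem_span_singleton.mp hx)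
  obtain ⟨p, hp, hsp, hpd⟩ := Ideal.exists_le_prime_disjoint _ _ hdisj
  have hp0 : p ≠ ⊥ := by
    rintro rfl
    exact hs (by simpa using hsp)
  have hpm : p ≤ m := fun x hx ↦ by
    by_contra hxm
    exact Set.disjoint_left.mp hpd hx ((le_sup_left : m.primeCompl ≤ _) hxm)
  have hpn : p ≤ n := fun x hx ↦ by
    by_contra hxn
    exact Set.disjoint_left.mp hpd hx ((le_sup_right : n.primeCompl ≤ _) hxn)
  exact hmn ((hR.existsUnique_maximal p hp hp0).unique ⟨‹_›, hpm⟩ ⟨‹_›, hpn⟩)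

/-- An element outside `m` that is divisible by `s` locally at every other maximal ideal. -/
theorem IsHLocalDomain.exists_notMem_forall_dvd_mul (hR : IsHLocalDomain R) (m : Ideal R)
    [m.IsMaximal] {s : R} (hs : s ≠ 0) :
    ∃ e ∉ m, ∀ n : Ideal R, n.IsMaximal → n ≠ m → ∃ t ∉ n, s ∣ t * e := by
  classical
  have key : ∀ n : Ideal R, ∃ e ∉ m, n.IsMaximal → n ≠ m → ∃ t ∉ n, s ∣ t * e := by
    intro n
    by_cases h : n.IsMaximal ∧ n ≠ m
    · obtain ⟨hn, hnm⟩ := h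
      obtain ⟨t, ht, u, hu, hd⟩ := hR.exists_dvd_mul hnm hs
      exact ⟨u, hu, fun _ _ ↦ ⟨t, ht, hd⟩⟩
    · exact ⟨1, m.one_notMem, fun h1 h2 ↦ (h ⟨h1, h2⟩).elim⟩
  choose e he hd using key
  refine ⟨∏ n ∈ (hR.finite_character s hs).toFinset, e n, fun hmem ↦ ?_, fun n hn hnm ↦ ?_⟩
  · obtain ⟨n, -, hn⟩ := (Ideal.IsPrime.prod_mem_iff (p := m)).mp hmem
    exact he n hn
  · by_cases hsn : s ∈ n
    · obtain ⟨t, ht, hd⟩ := hd n hn hnm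
      exact ⟨t, ht, hd.trans (mul_dvd_mul_left t (Finset.dvd_prod_of_mem e (by simp [hn, hsn])))⟩
    · exact ⟨s, hsn, dvd_mul_right s _⟩

end HLocal

/-! ### Lattices in free modules and their localizations -/

/-- A finitely generated torsion-free module of rank `r` over a domain `A` is isomorphic to a
submodule of `A ^ r` that contains `s • A ^ r`, for all sufficiently divisible `s`. -/
theorem exists_injective_smul_mem_range {A : Type u} [CommRing A] [IsDomain A] (M : Type v)
    [AddCommGroup M] [Module A M] [Module.Finite A M] [Module.IsTorsionFree A M] :
    ∃ a : A, a ≠ 0 ∧ ∀ s : A, s ≠ 0 → a ∣ s →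
      ∃ μ : M →ₗ[A] (Fin (Module.finrank A M) → A), Function.Injective μ ∧
        ∀ v, s • v ∈ LinearMap.range μ := by
  obtain ⟨b, hb⟩ := exists_linearIndependent_of_le_finrank (R := A) (M := M) le_rfl
  set B := Submodule.span A (Set.range b)
  have hB : Module.finrank A (M ⧸ B) = 0 := by
    have h1 := Submodule.finrank_quotient_add_finrank B
    have h2 : Module.finrank A B = _ := finrank_span_eq_card hb
    rw [Fintype.card_fin] at h2
    omega
  obtain ⟨a, ha, ha0⟩ := Submodule.annihilator_top_inter_nonZeroDivisors
    (Module.finrank_eq_zero_iff_isTorsion.mp hB)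
  refine ⟨a, nonZeroDivisors.ne_zero ha0, fun s hs ⟨c, hc⟩ ↦ ?_⟩
  have hsB : ∀ x, (LinearMap.lsmul A M s) x ∈ B := fun x ↦ by
    have h := Submodule.mem_annihilator.mp ha (Submodule.Quotient.mk (c • x)) trivial
    rw [← Submodule.Quotient.mk_smul, Submodule.Quotient.mk_eq_zero, ← mul_smul, ← hc] at h
    exact h
  set bB := Module.Basis.span hb
  refine ⟨bB.equivFun.toLinearMap ∘ₗ (LinearMap.lsmul A M s).codRestrict B hsB,
    bB.equivFun.injective.comp fun x y hxy ↦ ?_, fun v ↦ ?_⟩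
  · simpa [hs] using congrArg Subtype.val hxy
  · refine ⟨(bB.equivFun.symm v : M), ?_⟩
    have : (LinearMap.lsmul A M s).codRestrict B hsB (bB.equivFun.symm v) =
      s • bB.equivFun.symm v := Subtype.ext rfl
    rw [LinearMap.comp_apply, this, map_smul]
    exact congrArg (s • ·) (bB.equivFun.apply_symm_apply v)

section Lattice

variable {R : Type u} [CommRing R]

/-- The coordinatewise localization map `R ^ r → (S⁻¹ R) ^ r`. -/
abbrev localizationPi (S : Submonoid R) (r : ℕ) : (Fin r → R) →ₗ[R] (Fin r → Localization S) :=
  LinearMap.pi fun i ↦ Algebra.linearMap R (Localization S) ∘ₗ LinearMap.proj i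

/-- The localization of a submodule of `R ^ r` is the submodule it generates in `(S⁻¹ R) ^ r`. -/
theorem localizedModule_equiv_span (S : Submonoid R) {r : ℕ} (X : Submodule R (Fin r → R))
    {N : Submodule (Localization S) (Fin r → Localization S)}
    (hN : Submodule.span (Localization S) (localizationPi S r '' X) = N) :
    Nonempty (LocalizedModule S X ≃ₗ[Localization S] N) := by
  rw [← Submodule.localized'_eq_span (Localization S) S (localizationPi S r)] at hN
  subst hN
  exact ⟨(IsLocalizedModule.iso S (X.toLocalized' (Localization S) S
    (localizationPi S r))).extendScalarsOfIsLocalization S (Localization S)⟩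

theorem smul_unit_mem_iff {S : Submonoid R} {M : Type*} [AddCommGroup M]
    [Module R M] [Module (Localization S) M] [IsScalarTower R (Localization S) M]
    (N : Submodule (Localization S) M) {t : R} (ht : t ∈ S) {x : M} : t • x ∈ N ↔ x ∈ N := by
  rw [← algebraMap_smul (Localization S)]
  exact N.smul_mem_iff_of_isUnit (IsLocalization.map_units (Localization S) ⟨t, ht⟩)

/-- Here the localizations of `X` and of `s • R ^ r` coincide. -/
theorem localizedModule_equiv_pi [IsDomain R] (S : Submonoid R) (hS : (0 : R) ∉ S) {r : ℕ}
    (X : Submodule R (Fin r → R)) {s t : R} (hs : s ≠ 0) (ht : t ∈ S) (hsX : ∀ v, s • v ∈ X)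
    (htX : ∀ x ∈ X, ∃ v, t • x = s • v) :
    Nonempty (LocalizedModule S X ≃ₗ[Localization S] (Fin r → Localization S)) := by
  have hS' : S ≤ nonZeroDivisors R := le_nonZeroDivisors_of_noZeroDivisors hS
  have : IsDomain (Localization S) := IsLocalization.isDomain_localization hS'
  set σ := algebraMap R (Localization S) s
  have hσ : σ ≠ 0 := by
    rw [Ne, IsLocalization.to_map_eq_zero_iff _ hS']
    exact hs
  set μ := LinearMap.lsmul (Localization S) (Fin r → Localization S) σ
  have hμ : Function.Injective μ := fun x y hxy ↦ by simpa [μ, hσ] using hxy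
  have hsmul : ∀ v, μ (localizationPi S r v) = localizationPi S r (s • v) := fun v ↦ by
    simp [μ, σ]
  obtain ⟨e⟩ := localizedModule_equiv_span S X (N := LinearMap.range μ) <| by
    apply le_antisymm
    · rw [Submodule.span_le]
      rintro _ ⟨x, hx, rfl⟩
      obtain ⟨v, hv⟩ := htX x hx
      refine (smul_unit_mem_iff _ ht).mp ?_
      rw [← map_smul, hv, ← hsmul]
      exact ⟨_, rfl⟩
    · rintro _ ⟨v, rfl⟩
      obtain ⟨⟨v₀, c⟩, hc⟩ := IsLocalizedModule.surj S (localizationPi S r) v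
      refine (smul_unit_mem_iff _ c.2).mp ?_
      have : (c : R) • μ v = localizationPi S r (s • v₀) := by
        rw [← hsmul, ← hc, Submonoid.smul_def]
        exact (LinearMap.map_smul_of_tower μ (c : R) v).symm
      rw [this]
      exact Submodule.subset_span ⟨_, hsX v₀, rfl⟩
  exact ⟨e.trans (LinearEquiv.ofInjective μ hμ).symm⟩

theorem LocalizedModule.mkLinearMap_injective_of_isTorsionFree [IsDomain R] (S : Submonoid R)
    (hS : (0 : R) ∉ S) (X : Type w) [AddCommGroup X] [Module R X] [Module.IsTorsionFree R X] :
    Function.Injective (LocalizedModule.mkLinearMap S X) := by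
  refine (injective_iff_map_eq_zero _).mpr fun x hx ↦ ?_
  obtain ⟨c, hc⟩ := (IsLocalizedModule.eq_zero_iff S (LocalizedModule.mkLinearMap S X)).mp hx
  have hc0 : (c : R) ≠ 0 := fun h ↦ hS (h ▸ c.2)
  simpa [Submonoid.smul_def, hc0] using hc

/-- Indecomposability of a torsion-free module can be checked after localization. -/
theorem IsIndecomposableModule.of_localizedModule [IsDomain R] (S : Submonoid R)
    (hS : (0 : R) ∉ S) {X : Type w} [AddCommGroup X] [Module R X] [Module.IsTorsionFree R X]
    {M : Type v} [AddCommGroup M] [Module (Localization S) M]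
    (hM : IsIndecomposableModule (Localization S) M)
    (e : LocalizedModule S X ≃ₗ[Localization S] M) : IsIndecomposableModule R X := by
  have hinj := LocalizedModule.mkLinearMap_injective_of_isTorsionFree S hS X
  refine ⟨?_, fun N P hNP ↦ ?_⟩
  · by_contra h
    rw [not_nontrivial_iff_subsingleton] at h
    have := hM.nontrivial
    exact not_subsingleton M e.symm.injective.subsingleton
  · set φ := Submodule.localized'FrameHom (Localization S) S
      (LocalizedModule.mkLinearMap S X)
    have hφ : ∀ N, φ N = ⊥ → N = ⊥ := fun N h ↦ by
      refine (Submodule.eq_bot_iff _).mpr fun x hx ↦ hinj ?_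
      have hmem : LocalizedModule.mkLinearMap S X x ∈ φ N :=
        (Submodule.mem_localized' ..).mpr ⟨x, hx, 1, by simp⟩
      rw [h] at hmem
      rw [map_zero]
      exact (Submodule.mem_bot _).mp hmem
    have hc : IsCompl ((φ N).map e.toLinearMap) ((φ P).map e.toLinearMap) :=
      (hNP.map φ).map (Submodule.orderIsoMapComap e)
    have hbot : ∀ N, (φ N).map e.toLinearMap = ⊥ → N = ⊥ := fun N h ↦
      hφ N (by simpa using h)
    exact (hM.eq_bot_or_eq_bot _ _ hc).imp (hbot N) (hbot P)

end Lattice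

/-! ### Global forms of local modules -/

section GlobalForm

variable {R : Type u} [CommRing R]

/-- Finitely many vectors over `S⁻¹ R` have a common denominator. -/
theorem exists_smul_eq_localizationPi (S : Submonoid R) {r : ℕ}
    (G : Finset (Fin r → Localization S)) :
    ∃ t ∈ S, ∀ g ∈ G, ∃ x : Fin r → R, localizationPi S r x = t • g := by
  classical
  obtain ⟨t, ht⟩ := IsLocalization.exist_integer_multiples_of_finset S
    (G.biUnion fun g ↦ Finset.univ.image g)
  refine ⟨t, t.2, fun g hg ↦ ?_⟩
  have h : ∀ i, ∃ x : R, algebraMap R (Localization S) x = (t : R) • g i := fun i ↦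
    ht (g i) (Finset.mem_biUnion.mpr ⟨g, hg, Finset.mem_image_of_mem _ (Finset.mem_univ i)⟩)
  choose x hx using h
  exact ⟨x, funext fun i ↦ by simpa using hx i⟩

/-- A finitely generated torsion-free module `M` of rank `r` over `R_m` is the localization of a
submodule `X` of `R ^ r` containing `s • R ^ r`, such that `X` and `s • R ^ r` agree locally at all
other maximal ideals. -/
theorem IsHLocalDomain.exists_submodule_pi (hR : IsHLocalDomain R) (m : Ideal R) [m.IsMaximal]
    (M : Type v) [AddCommGroup M] [Module (Localization.AtPrime m) M]
    [Module.Finite (Localization.AtPrime m) M]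
    [Module.IsTorsionFree (Localization.AtPrime m) M] {r : ℕ}
    (hr : moduleRank (Localization.AtPrime m) M = r) :
    ∃ s₀ : R, s₀ ≠ 0 ∧ ∀ s : R, s ≠ 0 → s₀ ∣ s → ∃ X : Submodule R (Fin r → R),
      X.FG ∧ (∀ v, s • v ∈ X) ∧
      Nonempty (LocalizedModule m.primeCompl X ≃ₗ[Localization.AtPrime m] M) ∧
      ∀ n : Ideal R, n.IsMaximal → n ≠ m → ∃ t ∉ n, ∀ x ∈ X, ∃ v, t • x = s • v := by
  classical
  have := hR.isDomain
  rw [moduleRank_eq_finrank] at hr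
  subst hr
  set A := Localization.AtPrime m
  set S := m.primeCompl
  have hS : S ≤ nonZeroDivisors R := le_nonZeroDivisors_of_noZeroDivisors fun h ↦ h m.zero_mem
  obtain ⟨a, ha, hμ⟩ := exists_injective_smul_mem_range (A := A) M
  obtain ⟨⟨s₀, c⟩, hs₀⟩ := IsLocalization.surj S a
  have hinj := IsLocalization.injective A hS
  refine ⟨s₀, ?_, fun s hs hs₀s ↦ ?_⟩
  · rintro rfl
    rw [map_zero] at hs₀
    exact ha ((IsLocalization.map_units A c).mul_left_eq_zero.mp hs₀)
  obtain ⟨μ, hμinj, hsμ⟩ := hμ (algebraMap R A s)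
    (fun h ↦ hs (hinj (h.trans (map_zero _).symm)))
    ((Dvd.intro _ hs₀).trans ((algebraMap R A).map_dvd hs₀s))
  set N := LinearMap.range μ with hN
  obtain ⟨G, hG⟩ : N.FG := hN ▸ Module.Finite.iff_fg.mp inferInstance
  obtain ⟨t, ht, hx⟩ := exists_smul_eq_localizationPi S G
  have hx : ∀ g, ∃ x : Fin (Module.finrank A M) → R, g ∈ G → localizationPi S _ x = t • g :=
    fun g ↦ by
      by_cases hg : g ∈ G
      · exact (hx g hg).imp fun x hx _ ↦ hx
      · exact ⟨0, fun h ↦ (hg h).elim⟩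
  choose x hx using hx
  -- multiplied by `e`, the generators stay generators at `m` and move into `s • R ^ r` elsewhere
  obtain ⟨e, he, hen⟩ := hR.exists_notMem_forall_dvd_mul m hs
  set X : Submodule R (Fin (Module.finrank A M) → R) :=
    LinearMap.range (LinearMap.lsmul R (Fin (Module.finrank A M) → R) s) ⊔
      Submodule.span R ((fun g ↦ e • x g) '' G)
  have hsX : ∀ v, s • v ∈ X := fun v ↦ Submodule.mem_sup_left ⟨v, rfl⟩
  refine ⟨X, ?_, hsX, ?_, ?_⟩
  · exact (Module.Finite.iff_fg.mp inferInstance).sup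
      (Submodule.fg_span (G.finite_toSet.image _))
  · obtain ⟨f⟩ := localizedModule_equiv_span S X (N := N) <| by
      apply le_antisymm
      · suffices X ≤ (N.restrictScalars R).comap (localizationPi S _) by
          rw [Submodule.span_le]
          rintro _ ⟨y, hy, rfl⟩
          exact this hy
        refine sup_le ?_ (Submodule.span_le.mpr ?_)
        · rintro _ ⟨v, rfl⟩
          change localizationPi S _ (s • v) ∈ N
          rw [map_smul, ← algebraMap_smul A]
          exact hsμ _
        · rintro _ ⟨g, hg, rfl⟩
          change localizationPi S _ (e • x g) ∈ N
          rw [map_smul, hx g hg, smul_unit_mem_iff N he, smul_unit_mem_iff N ht, ← hG]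
          exact Submodule.subset_span hg
      · rw [← hG, Submodule.span_le]
        intro g hg
        refine (smul_unit_mem_iff _ ht).mp ((smul_unit_mem_iff _ (t := e) he).mp ?_)
        rw [← hx g hg, ← map_smul]
        exact Submodule.subset_span
          ⟨_, Submodule.mem_sup_right (Submodule.subset_span ⟨g, hg, rfl⟩), rfl⟩
    exact ⟨f.trans (LinearEquiv.ofInjective μ hμinj).symm⟩
  · intro n hn hnm
    obtain ⟨u, hu, d, hd⟩ := hen n hn hnm
    refine ⟨u, hu, fun y hy ↦ ?_⟩
    have hle : X ≤ (LinearMap.range (LinearMap.lsmul R (Fin (Module.finrank A M) → R) s)).comap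
        (LinearMap.lsmul R _ u) := by
      refine sup_le ?_ (Submodule.span_le.mpr ?_)
      · rintro _ ⟨v, rfl⟩
        exact ⟨u • v, smul_comm s u v⟩
      · rintro _ ⟨g, -, rfl⟩
        refine ⟨d • x g, ?_⟩
        simp only [LinearMap.lsmul_apply, ← mul_smul, hd]
    obtain ⟨v, hv⟩ := hle hy
    exact ⟨v, hv.symm⟩

theorem IsHLocalDomain.isGlobalForm (hR : IsHLocalDomain R) (m : Ideal R) [m.IsMaximal]
    (M : Type v) [AddCommGroup M] [Module (Localization.AtPrime m) M]
    (hM : IsIndecomposableModule (Localization.AtPrime m) M) {r : ℕ}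
    (hr : moduleRank (Localization.AtPrime m) M = r) {s : R} (hs : s ≠ 0)
    {X : Submodule R (Fin r → R)} (hX : X.FG) (hsX : ∀ v, s • v ∈ X)
    (hXM : Nonempty (LocalizedModule m.primeCompl X ≃ₗ[Localization.AtPrime m] M))
    (htX : ∀ n : Ideal R, n.IsMaximal → n ≠ m → ∃ t ∉ n, ∀ x ∈ X, ∃ v, t • x = s • v) :
    IsGlobalForm R m M X := by
  have := hR.isDomain
  subst hr
  obtain ⟨e⟩ := hXM
  refine ⟨Module.Finite.iff_fg.mpr hX, .of_localizedModule m.primeCompl (fun h ↦ h m.zero_mem)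
    hM e, inferInstance, ⟨e⟩, fun n hn hnm ↦ ?_⟩
  obtain ⟨t, ht, h⟩ := htX n hn hnm
  exact localizedModule_equiv_pi n.primeCompl (fun h ↦ h n.zero_mem) X hs ht hsX h

theorem IsHLocalDomain.exists_isGlobalForm (hR : IsHLocalDomain R) (m : Ideal R) [m.IsMaximal]
    (M : Type v) [AddCommGroup M] [Module (Localization.AtPrime m) M]
    [Module.Finite (Localization.AtPrime m) M]
    [Module.IsTorsionFree (Localization.AtPrime m) M]
    (hM : IsIndecomposableModule (Localization.AtPrime m) M) :
    ∃ (X : Type u) (_ : AddCommGroup X) (_ : Module R X), IsGlobalForm R m M X := by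
  obtain ⟨s, hs, h⟩ := hR.exists_submodule_pi m M rfl
  obtain ⟨X, hX, hsX, hXM, htX⟩ := h s hs dvd_rfl
  exact ⟨X, _, _, hR.isGlobalForm m M hM rfl hs hX hsX hXM htX⟩

end GlobalForm

/-! ### Endomorphisms factoring through copies of a module -/

section Factoring

variable {R : Type u} [CommRing R]

/-- The endomorphisms of `N` that factor through a finite direct sum of copies of `X`. The module
`N` is a direct summand of some `X ^ k` if and only if the identity is one of them. -/
def factoringEnd (R : Type*) [CommRing R] (N X : Type*) [AddCommGroup N] [Module R N]
    [AddCommGroup X] [Module R X] : Submodule R (Module.End R N) :=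
  Submodule.span R {f | ∃ (q : N →ₗ[R] X) (p : X →ₗ[R] N), p ∘ₗ q = f}

variable {N X Y : Type*} [AddCommGroup N] [Module R N] [AddCommGroup X] [Module R X]
  [AddCommGroup Y] [Module R Y]

theorem comp_mem_factoringEnd (q : N →ₗ[R] X) (p : X →ₗ[R] N) : p ∘ₗ q ∈ factoringEnd R N X :=
  Submodule.subset_span ⟨q, p, rfl⟩

theorem exists_comp_eq_of_mem_factoringEnd {f : Module.End R N} (hf : f ∈ factoringEnd R N X) :
    ∃ (k : ℕ) (q : N →ₗ[R] (Fin k → X)) (p : (Fin k → X) →ₗ[R] N), p ∘ₗ q = f := by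
  obtain ⟨k, c, g, rfl⟩ := Submodule.mem_span_set'.mp hf
  choose q p hpq using fun i ↦ (g i).2
  refine ⟨k, LinearMap.pi q, ∑ i, c i • p i ∘ₗ LinearMap.proj i, LinearMap.ext fun x ↦ ?_⟩
  simp [LinearMap.sum_apply, ← hpq]

/-- The image of a finitely generated module in a direct sum meets finitely many summands. -/
theorem comp_finsupp_mem_factoringEnd [Module.Finite R N] {ι : Type*} (q : N →ₗ[R] ι →₀ X)
    (p : (ι →₀ X) →ₗ[R] N) : p ∘ₗ q ∈ factoringEnd R N X := by
  classical
  obtain ⟨G, hG⟩ := Module.Finite.fg_top (R := R) (M := N)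
  set F := G.biUnion fun g ↦ (q g).support
  have hF : ∀ x, ∑ i ∈ F, Finsupp.lsingle (R := R) i (q x i) = q x := fun x ↦ by
    have : (∑ i ∈ F, Finsupp.lsingle i ∘ₗ Finsupp.lapply i) ∘ₗ q = q := by
      refine LinearMap.ext_on hG fun g hg ↦ ?_
      have hsub : (q g).support ⊆ F := Finset.subset_biUnion_of_mem (fun g ↦ (q g).support) hg
      simpa [LinearMap.sum_apply, Finsupp.sum] using
        (Finsupp.sum_of_support_subset (q g) hsub Finsupp.single (by simp)).symm.trans
          (Finsupp.sum_single (q g))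
    simpa [LinearMap.sum_apply] using LinearMap.congr_fun this x
  have : p ∘ₗ q = ∑ i ∈ F, (p ∘ₗ Finsupp.lsingle i) ∘ₗ (Finsupp.lapply i ∘ₗ q) := by
    refine LinearMap.ext fun x ↦ ?_
    rw [LinearMap.comp_apply, ← hF x]
    simp [LinearMap.sum_apply]
  rw [this]
  exact Submodule.sum_mem _ fun i _ ↦ comp_mem_factoringEnd _ _

/-- Being a direct summand of some `X ^ k` is a local property. -/
theorem one_mem_factoringEnd_of_forall_isMaximal
    (h : ∀ n : Ideal R, n.IsMaximal → ∃ t ∉ n, t • (1 : Module.End R N) ∈ factoringEnd R N X) :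
    1 ∈ factoringEnd R N X := by
  set I : Ideal R := (factoringEnd R N X).comap (LinearMap.toSpanSingleton R (Module.End R N) 1)
  have hI : I = ⊤ := by
    by_contra hI
    obtain ⟨n, hn, hIn⟩ := Ideal.exists_le_maximal I hI
    obtain ⟨t, ht, htI⟩ := h n hn
    exact ht (hIn htI)
  have h1 : (1 : R) ∈ I := hI ▸ Submodule.mem_top
  simpa [I] using h1

/-- A map between localizations lifts up to a denominator, if its source comes from a finitely
generated module `N` and `X` embeds into its localization; `X` need not be finitely presented. -/
theorem exists_lift_smul_of_finite (S : Submonoid R) {N' X' : Type*} [AddCommGroup N'] [Module R N']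
    [AddCommGroup X'] [Module R X'] (f : N →ₗ[R] N') (g : X →ₗ[R] X') [IsLocalizedModule S g]
    (hg : Function.Injective g) [Module.Finite R N] (u : N' →ₗ[R] X') :
    ∃ t ∈ S, ∃ q : N →ₗ[R] X, g ∘ₗ q = t • u ∘ₗ f := by
  classical
  obtain ⟨G, hG⟩ := Module.Finite.fg_top (R := R) (M := N)
  obtain ⟨t, ht⟩ := IsLocalizedModule.exist_integer_multiples_of_finset S g (G.image (u ∘ₗ f))
  have hle : ∀ x, (t : R) • u (f x) ∈ LinearMap.range g := by
    suffices ⊤ ≤ (LinearMap.range g).comap ((t : R) • u ∘ₗ f) from fun x ↦ this trivial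
    rw [← hG, Submodule.span_le]
    exact fun x hx ↦ ht _ (Finset.mem_image_of_mem _ hx)
  refine ⟨t, t.2, (LinearEquiv.ofInjective g hg).symm.toLinearMap ∘ₗ
    ((t : R) • u ∘ₗ f).codRestrict (LinearMap.range g) hle, LinearMap.ext fun x ↦ ?_⟩
  have := LinearEquiv.apply_symm_apply (LinearEquiv.ofInjective g hg)
    (((t : R) • u ∘ₗ f).codRestrict (LinearMap.range g) hle x)
  exact congrArg Subtype.val this

/-- A splitting of the localization of `N` off the localization of `X` lifts, up to a denominator,
to maps between `N` and `X`. -/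
theorem exists_smul_one_mem_factoringEnd (S : Submonoid R) {N' X' : Type*}
    [AddCommGroup N'] [Module R N'] [AddCommGroup X'] [Module R X'] (f : N →ₗ[R] N')
    (g : X →ₗ[R] X') [IsLocalizedModule S f] [IsLocalizedModule S g]
    (hf : Function.Injective f) (hg : Function.Injective g) [Module.Finite R N] [Module.Finite R X]
    (u : N' →ₗ[R] X') (v : X' →ₗ[R] N') (hvu : v ∘ₗ u = LinearMap.id) :
    ∃ t ∈ S, t • (1 : Module.End R N) ∈ factoringEnd R N X := by
  obtain ⟨t, ht, q, hq⟩ := exists_lift_smul_of_finite S f g hg u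
  obtain ⟨t', ht', p, hp⟩ := exists_lift_smul_of_finite S g f hf v
  refine ⟨t' * t, mul_mem ht' ht, ?_⟩
  have : (t' * t) • (1 : Module.End R N) = p ∘ₗ q := by
    refine LinearMap.ext fun x ↦ hf ?_
    have h1 : f (p (q x)) = t' • v (g (q x)) := LinearMap.congr_fun hp (q x)
    have h2 : g (q x) = t • u (f x) := LinearMap.congr_fun hq x
    have h3 : v (u (f x)) = f x := LinearMap.congr_fun hvu (f x)
    simp [h1, h2, h3, mul_smul]
  rw [this]
  exact comp_mem_factoringEnd q p

theorem map_mem_factoringEnd (S : Submonoid R) {f : Module.End R N}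
    (hf : f ∈ factoringEnd R N X) {M : Type*} [AddCommGroup M] [Module (Localization S) M]
    (e : LocalizedModule S X ≃ₗ[Localization S] M) :
    LocalizedModule.map S f ∈ factoringEnd (Localization S) (LocalizedModule S N) M := by
  induction hf using Submodule.span_induction with
  | mem f hf =>
    obtain ⟨q, p, rfl⟩ := hf
    have : LocalizedModule.map S (p ∘ₗ q) =
        (LocalizedModule.map S p ∘ₗ e.symm.toLinearMap) ∘ₗ
          (e.toLinearMap ∘ₗ LocalizedModule.map S q) := by
      refine LinearMap.ext fun x ↦ ?_
      induction x using LocalizedModule.induction_on with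
      | h n s => simp [LocalizedModule.map_mk]
    rw [this]
    exact comp_mem_factoringEnd _ _
  | zero => simp
  | add f g _ _ hf hg =>
    rw [map_add]
    exact add_mem hf hg
  | smul c f _ hf =>
    rw [map_smul, ← algebraMap_smul (Localization S)]
    exact Submodule.smul_mem _ _ hf

end Factoring

section Compare

variable {R : Type u} [CommRing R]

theorem factoringEnd_le_of_comp_eq_id {N X Y : Type*} [AddCommGroup N] [Module R N]
    [AddCommGroup X] [Module R X] [AddCommGroup Y] [Module R Y] (q : X →ₗ[R] Y) (p : Y →ₗ[R] X)
    (hpq : p ∘ₗ q = LinearMap.id) : factoringEnd R N X ≤ factoringEnd R N Y := by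
  refine Submodule.span_le.mpr ?_
  rintro _ ⟨q', p', rfl⟩
  have : p' ∘ₗ q' = (p' ∘ₗ p) ∘ₗ (q ∘ₗ q') :=
    LinearMap.ext fun x ↦ congrArg p' (LinearMap.congr_fun hpq (q' x)).symm
  rw [this]
  exact comp_mem_factoringEnd _ _

/-- The global forms of a given module are locally isomorphic, hence direct summands of direct sums
of copies of one another. -/
theorem IsGlobalForm.one_mem_factoringEnd [IsDomain R] {m : Ideal R} [m.IsMaximal] {M : Type v}
    [AddCommGroup M] [Module (Localization.AtPrime m) M] {X Y : Type*} [AddCommGroup X]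
    [Module R X] [AddCommGroup Y] [Module R Y] (hX : IsGlobalForm R m M X)
    (hY : IsGlobalForm R m M Y) : 1 ∈ factoringEnd R X Y := by
  have := hX.finite
  have := hY.finite
  have := hX.torsionFree
  have := hY.torsionFree
  refine one_mem_factoringEnd_of_forall_isMaximal fun n hn ↦ ?_
  obtain ⟨e⟩ : Nonempty (LocalizedModule n.primeCompl X ≃ₗ[Localization.AtPrime n]
      LocalizedModule n.primeCompl Y) := by
    by_cases h : n = m
    · subst h
      obtain ⟨e₁⟩ := hX.localization_equiv
      obtain ⟨e₂⟩ := hY.localization_equiv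
      exact ⟨e₁.trans e₂.symm⟩
    · obtain ⟨e₁⟩ := hX.localization_free n h
      obtain ⟨e₂⟩ := hY.localization_free n h
      exact ⟨e₁.trans e₂.symm⟩
  have hn0 : (0 : R) ∉ n.primeCompl := fun h ↦ h n.zero_mem
  exact exists_smul_one_mem_factoringEnd n.primeCompl
    (LocalizedModule.mkLinearMap n.primeCompl X) (LocalizedModule.mkLinearMap n.primeCompl Y)
    (LocalizedModule.mkLinearMap_injective_of_isTorsionFree _ hn0 X)
    (LocalizedModule.mkLinearMap_injective_of_isTorsionFree _ hn0 Y)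
    (e.toLinearMap.restrictScalars R) (e.symm.toLinearMap.restrictScalars R)
    (LinearMap.ext fun x ↦ by simp)

/-- Locally at any maximal ideal other than `m`, the ring is a direct summand of a global form. -/
theorem IsGlobalForm.exists_smul_one_mem_factoringEnd_self [IsDomain R] {m : Ideal R} [m.IsMaximal]
    {M : Type v} [AddCommGroup M] [Module (Localization.AtPrime m) M]
    (hM : moduleRank (Localization.AtPrime m) M ≠ 0) {X : Type*} [AddCommGroup X]
    [Module R X] (hX : IsGlobalForm R m M X) (n : Ideal R) [n.IsMaximal] (hn : n ≠ m) :
    ∃ t ∉ n, t • (1 : Module.End R R) ∈ factoringEnd R R X := by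
  have := hX.finite
  have := hX.torsionFree
  obtain ⟨e⟩ := hX.localization_free n hn
  have hn0 : (0 : R) ∉ n.primeCompl := fun h ↦ h n.zero_mem
  let i : Fin (moduleRank (Localization.AtPrime m) M) := ⟨0, Nat.pos_of_ne_zero hM⟩
  exact exists_smul_one_mem_factoringEnd n.primeCompl
    (Algebra.linearMap R (Localization.AtPrime n)) (LocalizedModule.mkLinearMap n.primeCompl X)
    (IsLocalization.injective _ (le_nonZeroDivisors_of_noZeroDivisors hn0))
    (LocalizedModule.mkLinearMap_injective_of_isTorsionFree _ hn0 X)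
    ((e.symm.toLinearMap ∘ₗ LinearMap.single (Localization.AtPrime n) _ i).restrictScalars R)
    ((LinearMap.proj i ∘ₗ e.toLinearMap).restrictScalars R)
    (LinearMap.ext fun x ↦ by simp)

/-- As every maximal ideal differs from `m₁` or from `m₂`, the ring is a direct summand of a direct
sum of copies of `X₁ ⊕ X₂`. -/
theorem one_mem_factoringEnd_self_prod [IsDomain R] {m₁ m₂ : Ideal R} [m₁.IsMaximal]
    [m₂.IsMaximal] (hm : m₁ ≠ m₂) {M₁ : Type v} [AddCommGroup M₁]
    [Module (Localization.AtPrime m₁) M₁] {M₂ : Type w} [AddCommGroup M₂]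
    [Module (Localization.AtPrime m₂) M₂] (hM₁ : moduleRank (Localization.AtPrime m₁) M₁ ≠ 0)
    (hM₂ : moduleRank (Localization.AtPrime m₂) M₂ ≠ 0) {X₁ X₂ : Type*} [AddCommGroup X₁]
    [Module R X₁] [AddCommGroup X₂] [Module R X₂] (h₁ : IsGlobalForm R m₁ M₁ X₁)
    (h₂ : IsGlobalForm R m₂ M₂ X₂) : 1 ∈ factoringEnd R R (X₁ × X₂) := by
  refine one_mem_factoringEnd_of_forall_isMaximal fun n hn ↦ ?_
  by_cases h : n = m₁
  · obtain ⟨t, ht, h⟩ := h₂.exists_smul_one_mem_factoringEnd_self hM₂ n (h.trans_ne hm)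
    exact ⟨t, ht, factoringEnd_le_of_comp_eq_id (LinearMap.inr R X₁ X₂) (LinearMap.snd R X₁ X₂)
      (LinearMap.snd_comp_inr ..) h⟩
  · obtain ⟨t, ht, h⟩ := h₁.exists_smul_one_mem_factoringEnd_self hM₁ n h
    exact ⟨t, ht, factoringEnd_le_of_comp_eq_id (LinearMap.inl R X₁ X₂) (LinearMap.fst R X₁ X₂)
      (LinearMap.fst_comp_inl ..) h⟩

end Compare

/-! ### Closure properties of `Add` -/

section Add

variable {R : Type u} [CommRing R] {X : Type v} [AddCommGroup X] [Module R X]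
  {L L' : Type w} [AddCommGroup L] [Module R L] [AddCommGroup L'] [Module R L']

theorem memAdd_iff_exists_comp_eq_id : MemAdd R X L ↔
    ∃ (ι : Type w) (i : L →ₗ[R] ι →₀ X) (p : (ι →₀ X) →ₗ[R] L), p ∘ₗ i = LinearMap.id := by
  constructor
  · rintro ⟨ι, N, P, hNP, ⟨e⟩⟩
    refine ⟨ι, N.subtype ∘ₗ e.toLinearMap, e.symm.toLinearMap ∘ₗ N.projectionOnto P hNP,
      LinearMap.ext fun x ↦ ?_⟩
    simp
  · rintro ⟨ι, i, p, hpi⟩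
    have hi : Function.Injective i :=
      Function.LeftInverse.injective (g := p) (LinearMap.congr_fun hpi)
    refine ⟨ι, LinearMap.range i, LinearMap.ker (i.rangeRestrict ∘ₗ p),
      LinearMap.isCompl_of_proj ?_, ⟨LinearEquiv.ofInjective i hi⟩⟩
    rintro ⟨_, x, rfl⟩
    refine Subtype.ext ?_
    exact congrArg i (LinearMap.congr_fun hpi x)

theorem MemAdd.of_comp_eq_id (h : MemAdd R X L') (i : L →ₗ[R] L') (p : L' →ₗ[R] L)
    (hpi : p ∘ₗ i = LinearMap.id) : MemAdd R X L := by
  rw [memAdd_iff_exists_comp_eq_id] at h ⊢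
  obtain ⟨ι, i', p', h⟩ := h
  refine ⟨ι, i' ∘ₗ i, p ∘ₗ p', LinearMap.ext fun x ↦ ?_⟩
  have h1 : p' (i' (i x)) = i x := LinearMap.congr_fun h (i x)
  have h2 : p (i x) = x := LinearMap.congr_fun hpi x
  simp [h1, h2]

theorem MemAdd.prod (h : MemAdd R X L) (h' : MemAdd R X L') : MemAdd R X (L × L') := by
  rw [memAdd_iff_exists_comp_eq_id] at h h' ⊢
  obtain ⟨ι, i, p, h⟩ := h
  obtain ⟨ι', i', p', h'⟩ := h'
  let e := Finsupp.sumFinsuppLEquivProdFinsupp (M := X) (α := ι) (β := ι') R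
  refine ⟨ι ⊕ ι', e.symm.toLinearMap ∘ₗ i.prodMap i', p.prodMap p' ∘ₗ e.toLinearMap,
    LinearMap.ext fun x ↦ ?_⟩
  have h1 : p (i x.1) = x.1 := LinearMap.congr_fun h x.1
  have h2 : p' (i' x.2) = x.2 := LinearMap.congr_fun h' x.2
  simp [h1, h2]

theorem MemAdd.finsupp (h : MemAdd R X L) (κ : Type) : MemAdd R X (κ →₀ L) := by
  rw [memAdd_iff_exists_comp_eq_id] at h ⊢
  obtain ⟨ι, i, p, h⟩ := h
  let e := Finsupp.curryLinearEquiv (M := X) (α := κ) (β := ι) R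
  refine ⟨κ × ι, e.symm.toLinearMap ∘ₗ Finsupp.mapRange.linearMap i,
    Finsupp.mapRange.linearMap p ∘ₗ e.toLinearMap, LinearMap.ext fun x ↦ Finsupp.ext fun k ↦ ?_⟩
  have h1 : p (i (x k)) = x k := LinearMap.congr_fun h (x k)
  simp [h1]

theorem MemAdd.of_one_mem_factoringEnd (h : 1 ∈ factoringEnd R L X) : MemAdd R X L := by
  rw [memAdd_iff_exists_comp_eq_id]
  obtain ⟨k, q, p, h⟩ := exists_comp_eq_of_mem_factoringEnd h
  let e := (Finsupp.linearEquivFunOnFinite R X (ULift.{w} (Fin k))).trans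
    (LinearEquiv.funCongrLeft R X Equiv.ulift.symm)
  refine ⟨ULift (Fin k), e.symm.toLinearMap ∘ₗ q, p ∘ₗ e.toLinearMap, LinearMap.ext fun x ↦ ?_⟩
  have h1 : p (q x) = x := LinearMap.congr_fun h x
  simp [h1]

end Add

/-! ### Amalgamating two lattices of infinite rank -/

section Amalgam

variable {R : Type u} [CommRing R]

theorem exists_mapRange_subtype_eq_smul {W : Type*} [AddCommGroup W] [Module R W]
    (Y : Submodule R W) {s : R} (hs : ∀ v, s • v ∈ Y) (w : ℕ →₀ W) :
    ∃ y, Finsupp.mapRange.linearMap (α := ℕ) Y.subtype y = s • w :=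
  ⟨Finsupp.mapRange.linearMap ((LinearMap.lsmul R W s).codRestrict Y hs) w,
    Finsupp.ext fun _ ↦ rfl⟩

theorem exists_smul_mapRange_subtype_eq {W : Type*} [AddCommGroup W] [Module R W]
    (Y : Submodule R W) {s t : R} (ht : ∀ y ∈ Y, ∃ v, t • y = s • v) (y : ℕ →₀ Y) :
    ∃ w, t • Finsupp.mapRange.linearMap (α := ℕ) Y.subtype y = s • w := by
  induction y using Finsupp.induction_linear with
  | zero => exact ⟨0, by simp⟩
  | add y y' hy hy' =>
    obtain ⟨w, hw⟩ := hy
    obtain ⟨w', hw'⟩ := hy'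
    exact ⟨w + w', by rw [map_add, smul_add, smul_add, hw, hw']⟩
  | single i y =>
    obtain ⟨v, hv⟩ := ht y y.2
    exact ⟨Finsupp.single i v, by simp [hv]⟩

/-- If `t` multiplies a submodule `L` into the image of an injective map `α`, then multiplication
by `t` on `L` factors through the source of `α`. -/
theorem exists_factorization_smul {V P : Type*} [AddCommGroup V] [Module R V] [AddCommGroup P]
    [Module R P] {α : P →ₗ[R] V} (hα : Function.Injective α) {L : Submodule R V}
    (hL : LinearMap.range α ≤ L) {t : R} (ht : ∀ x ∈ L, t • x ∈ LinearMap.range α) :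
    ∃ κ : L →ₗ[R] P, α.codRestrict L (fun x ↦ hL ⟨x, rfl⟩) ∘ₗ κ = t • LinearMap.id ∧
      κ ∘ₗ α.codRestrict L (fun x ↦ hL ⟨x, rfl⟩) = t • LinearMap.id := by
  set κ : L →ₗ[R] P := (LinearEquiv.ofInjective α hα).symm.toLinearMap ∘ₗ
    (LinearMap.lsmul R V t ∘ₗ L.subtype).codRestrict (LinearMap.range α) fun x ↦ ht x x.2
  have hκ : ∀ x, α (κ x) = t • x := fun x ↦
    congrArg Subtype.val (LinearEquiv.apply_symm_apply (LinearEquiv.ofInjective α hα) _)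
  refine ⟨κ, LinearMap.ext fun x ↦ Subtype.ext (hκ x), LinearMap.ext fun x ↦ hα ?_⟩
  rw [LinearMap.comp_apply, hκ]
  simp

theorem nonempty_linearEquiv_prod_finsupp [IsDomain R] {r₁ r₂ : ℕ} (h₁ : r₁ ≠ 0) (h₂ : r₂ ≠ 0) :
    Nonempty ((R × (ℕ →₀ (Fin r₁ → R))) ≃ₗ[R] (ℕ →₀ (Fin r₂ → R))) := by
  refine nonempty_linearEquiv_of_rank_eq ?_
  have key : ∀ {r : ℕ}, r ≠ 0 → Module.rank R (ℕ →₀ (Fin r → R)) = Cardinal.aleph0 := fun h ↦ by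
    rw [rank_finsupp]
    simp [h, Cardinal.aleph0_mul_nat]
  rw [rank_prod', key h₁, key h₂, Module.rank_self]
  exact Cardinal.add_eq_right le_rfl Cardinal.one_le_aleph0

/-- The sum of the images of two injective maps `α` and `β`. Multiplication by a scalar that takes
one of the images into the other one factors through the latter. -/
theorem exists_submodule_factorization_smul {V P G : Type*} [AddCommGroup V] [Module R V]
    [AddCommGroup P] [Module R P] [AddCommGroup G] [Module R G] {α : P →ₗ[R] V} {β : G →ₗ[R] V}
    (hα : Function.Injective α) (hβ : Function.Injective β) :
    ∃ (L : Submodule R V) (α' : P →ₗ[R] L) (β' : G →ₗ[R] L),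
      (∀ t : R, (∀ z, t • β z ∈ LinearMap.range α) →
        ∃ κ : L →ₗ[R] P, α' ∘ₗ κ = t • LinearMap.id ∧ κ ∘ₗ α' = t • LinearMap.id) ∧
      ∀ t : R, (∀ y, t • α y ∈ LinearMap.range β) →
        ∃ κ : L →ₗ[R] G, β' ∘ₗ κ = t • LinearMap.id := by
  refine ⟨LinearMap.range α ⊔ LinearMap.range β,
    α.codRestrict _ fun x ↦ Submodule.mem_sup_left ⟨x, rfl⟩,
    β.codRestrict _ fun x ↦ Submodule.mem_sup_right ⟨x, rfl⟩, fun t ht ↦ ?_, fun t ht ↦ ?_⟩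
  · refine exists_factorization_smul hα (L := LinearMap.range α ⊔ LinearMap.range β)
      le_sup_left fun x hx ↦ ?_
    obtain ⟨_, ⟨y, rfl⟩, _, ⟨z, rfl⟩, rfl⟩ := Submodule.mem_sup.mp hx
    rw [smul_add]
    exact add_mem (Submodule.smul_mem _ t ⟨y, rfl⟩) (ht z)
  · refine (exists_factorization_smul hβ (L := LinearMap.range α ⊔ LinearMap.range β)
      le_sup_right fun x hx ↦ ?_).imp fun _ h ↦ h.1
    obtain ⟨_, ⟨y, rfl⟩, _, ⟨z, rfl⟩, rfl⟩ := Submodule.mem_sup.mp hx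
    rw [smul_add]
    exact add_mem (ht y) (Submodule.smul_mem _ t ⟨z, rfl⟩)

/-- Two lattices `R ⊕ Y ^ (ℕ)` and `Z ^ (ℕ)` in a common free module of countable rank. -/
theorem exists_injective_into_free [IsDomain R] {r₁ r₂ : ℕ} (h₁ : r₁ ≠ 0) (h₂ : r₂ ≠ 0) {s : R}
    (hs : s ≠ 0) (Y : Submodule R (Fin r₁ → R)) (Z : Submodule R (Fin r₂ → R))
    (hY : ∀ v, s • v ∈ Y) (hZ : ∀ v, s • v ∈ Z) :
    ∃ (α : (R × (ℕ →₀ Y)) →ₗ[R] ℕ →₀ (Fin r₂ → R)) (β : (ℕ →₀ Z) →ₗ[R] ℕ →₀ (Fin r₂ → R)),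
      Function.Injective α ∧ Function.Injective β ∧
      (∀ t : R, (∀ z ∈ Z, ∃ v, t • z = s • v) → ∀ z, t • β z ∈ LinearMap.range α) ∧
      ∀ t : R, (∀ y ∈ Y, ∃ v, t • y = s • v) → ∀ y, t • α y ∈ LinearMap.range β := by
  obtain ⟨φ⟩ := nonempty_linearEquiv_prod_finsupp (R := R) h₁ h₂
  have hα : Function.Injective ((LinearMap.lsmul R R s).prodMap
      (Finsupp.mapRange.linearMap (α := ℕ) Y.subtype)) := by
    rw [LinearMap.coe_prodMap]
    refine Function.Injective.prodMap (fun x y hxy ↦ ?_) ?_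
    · simpa [hs] using hxy
    · exact Finsupp.mapRange_injective _ rfl Subtype.val_injective
  refine ⟨φ.toLinearMap ∘ₗ
    (LinearMap.lsmul R R s).prodMap (Finsupp.mapRange.linearMap (α := ℕ) Y.subtype),
    Finsupp.mapRange.linearMap Z.subtype, φ.injective.comp hα,
    Finsupp.mapRange_injective _ rfl Subtype.val_injective, fun t ht z ↦ ?_, fun t ht y ↦ ?_⟩
  · obtain ⟨w, hw⟩ := exists_smul_mapRange_subtype_eq Z ht z
    obtain ⟨y, hy⟩ := exists_mapRange_subtype_eq_smul Y hY (φ.symm w).2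
    refine ⟨((φ.symm w).1, y), ?_⟩
    have h : ((LinearMap.lsmul R R s).prodMap (Finsupp.mapRange.linearMap (α := ℕ) Y.subtype))
        ((φ.symm w).1, y) = s • φ.symm w := Prod.ext rfl hy
    rw [LinearMap.comp_apply, h, hw, map_smul]
    exact congrArg (s • ·) (φ.apply_symm_apply w)
  · obtain ⟨c, y⟩ := y
    obtain ⟨w, hw⟩ := exists_smul_mapRange_subtype_eq Y ht y
    have h : t • ((LinearMap.lsmul R R s).prodMap (Finsupp.mapRange.linearMap (α := ℕ) Y.subtype))
        (c, y) = s • (t * c, w) := Prod.ext (mul_left_comm t s c) hw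
    rw [LinearMap.comp_apply, ← map_smul, h, map_smul]
    exact exists_mapRange_subtype_eq_smul Z hZ _

/-- The amalgam `L` of `P = R ⊕ Y ^ (ℕ)` and `G = Z ^ (ℕ)`: it is the sum of `P` and `G` inside a
common free module `V` of countable rank, where both contain `s • V`. Locally where `Z` agrees with
`s • R ^ r₂`, the module `L` agrees with `P`, and locally where `Y` agrees with `s • R ^ r₁`,
it agrees with `G`; this is expressed by factorizations of multiplications by scalars. -/
theorem exists_amalgam [IsDomain R] {r₁ r₂ : ℕ} (h₁ : r₁ ≠ 0) (h₂ : r₂ ≠ 0) {s : R} (hs : s ≠ 0)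
    (Y : Submodule R (Fin r₁ → R)) (Z : Submodule R (Fin r₂ → R)) (hY : ∀ v, s • v ∈ Y)
    (hZ : ∀ v, s • v ∈ Z) :
    ∃ (L : Type u) (_ : AddCommGroup L) (_ : Module R L) (α : (R × (ℕ →₀ Y)) →ₗ[R] L)
      (β : (ℕ →₀ Z) →ₗ[R] L),
      (∀ t : R, (∀ z ∈ Z, ∃ v, t • z = s • v) →
        ∃ κ : L →ₗ[R] R × (ℕ →₀ Y), α ∘ₗ κ = t • LinearMap.id ∧ κ ∘ₗ α = t • LinearMap.id) ∧
      ∀ t : R, (∀ y ∈ Y, ∃ v, t • y = s • v) →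
        ∃ κ : L →ₗ[R] ℕ →₀ Z, β ∘ₗ κ = t • LinearMap.id := by
  obtain ⟨α, β, hα, hβ, hβα, hαβ⟩ := exists_injective_into_free h₁ h₂ hs Y Z hY hZ
  obtain ⟨L, α', β', h, h'⟩ :=
    exists_submodule_factorization_smul (V := ℕ →₀ (Fin r₂ → R)) (P := R × (ℕ →₀ Y))
      (G := ℕ →₀ Z) hα hβ
  exact ⟨L, inferInstance, inferInstance, α', β', fun t ht ↦ h t (hβα t ht),
    fun t ht ↦ h' t (hαβ t ht)⟩

end Amalgam

/-! ### Finitely generated summands of the amalgam -/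

section Summands

variable {R : Type u} [CommRing R]

theorem nonempty_prod_ker_equiv {A : Type*} [Ring A] {N K : Type*} [AddCommGroup N] [Module A N]
    [AddCommGroup K] [Module A K] (q : N →ₗ[A] K) (p : K →ₗ[A] N) (hpq : p ∘ₗ q = LinearMap.id) :
    Nonempty ((N × LinearMap.ker p) ≃ₗ[A] K) := by
  have h : ∀ x, p (q x) = x := LinearMap.congr_fun hpq
  refine ⟨LinearEquiv.ofLinearMap (q.coprod (LinearMap.ker p).subtype)
    (p.prod ((LinearMap.id - q ∘ₗ p).codRestrict (LinearMap.ker p) fun x ↦ by simp [h])) ?_ ?_⟩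
  · ext x; simp
  · refine LinearMap.ext fun ⟨x, k⟩ ↦ Prod.ext ?_ (Subtype.ext ?_)
    · simp [h]
    · simp [h]

theorem finrank_localizedModule [IsDomain R] (S : Submonoid R) (hS : (0 : R) ∉ S)
    (N : Type*) [AddCommGroup N] [Module R N] :
    Module.finrank (Localization S) (LocalizedModule S N) = Module.finrank R N := by
  have hS' : S ≤ nonZeroDivisors R := le_nonZeroDivisors_of_noZeroDivisors hS
  rw [IsLocalization.finrank_eq (Localization S) S hS',
    IsLocalizedModule.finrank_eq S (LocalizedModule.mkLinearMap S N) hS']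

theorem LocalizedModule.map_smul_one (S : Submonoid R) (N : Type*) [AddCommGroup N] [Module R N]
    (t : R) : LocalizedModule.map S (t • (1 : Module.End R N)) =
      algebraMap R (Localization S) t •
        (1 : Module.End (Localization S) (LocalizedModule S N)) := by
  rw [map_smul, algebraMap_smul]
  congr 1
  refine LinearMap.ext fun x ↦ ?_
  induction x using LocalizedModule.induction_on with
  | h n s => simp [LocalizedModule.map_mk]

theorem finrank_dvd_of_smul_one_mem_factoringEnd [IsDomain R] (S : Submonoid R) (hS : (0 : R) ∉ S)
    {M : Type v} [AddCommGroup M] [Module (Localization S) M] [Module.Finite (Localization S) M]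
    [IsLocalRing (Module.End (Localization S) M)] {N X : Type*} [AddCommGroup N] [Module R N]
    [AddCommGroup X] [Module R X] (e : LocalizedModule S X ≃ₗ[Localization S] M) {t : R}
    (ht : t ∈ S) (h : t • (1 : Module.End R N) ∈ factoringEnd R N X) :
    Module.finrank (Localization S) M ∣ Module.finrank R N := by
  have : IsDomain (Localization S) :=
    IsLocalization.isDomain_localization (le_nonZeroDivisors_of_noZeroDivisors hS)
  have h1 := map_mem_factoringEnd S h e
  rw [LocalizedModule.map_smul_one,
    Submodule.smul_mem_iff_of_isUnit _ (IsLocalization.map_units (Localization S) ⟨t, ht⟩)] at h1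
  obtain ⟨k, q, p, hpq⟩ := exists_comp_eq_of_mem_factoringEnd h1
  obtain ⟨f⟩ := nonempty_prod_ker_equiv q p hpq
  rw [← finrank_localizedModule S hS N]
  exact finrank_dvd_of_prod_equiv_pi k f

/-- The hypotheses say that, up to scalars outside `m`, the module `N` is a direct summand of some
`R ⊕ X ^ k` and `R` is a direct summand of `N`. Localization at `m` makes the scalars invertible and
leads to the situation of `exists_finrank_eq_one_add_mul`. -/
theorem exists_finrank_eq_one_add_mul_of_localized [IsDomain R] (m : Ideal R) [m.IsPrime]
    {M : Type v} [AddCommGroup M] [Module (Localization.AtPrime m) M]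
    [Module.Finite (Localization.AtPrime m) M]
    [IsLocalRing (Module.End (Localization.AtPrime m) M)] {N X : Type*} [AddCommGroup N]
    [Module R N] [AddCommGroup X] [Module R X]
    (e : LocalizedModule m.primeCompl X ≃ₗ[Localization.AtPrime m] M) {t : R} (ht : t ∉ m)
    (q : N →ₗ[R] R) (p : R →ₗ[R] N) {g : Module.End R N} (hg : g ∈ factoringEnd R N X)
    (h : t • (1 : Module.End R N) = p ∘ₗ q + g) {y : N} {f : N →ₗ[R] R} (hy : f y ∉ m) :
    ∃ c, Module.finrank R N = 1 + Module.finrank (Localization.AtPrime m) M * c := by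
  set S := m.primeCompl
  set A := Localization.AtPrime m
  set ε : LocalizedModule S R ≃ₗ[A] A :=
    (IsLocalizedModule.iso S (Algebra.linearMap R A)).extendScalarsOfIsLocalization S A
  obtain ⟨k, q', p', hpq⟩ := exists_comp_eq_of_mem_factoringEnd (map_mem_factoringEnd S hg e)
  obtain ⟨τ, hτ⟩ := IsLocalization.map_units A (⟨t, ht⟩ : S)
  obtain ⟨σ, hσ⟩ := IsLocalization.map_units A (⟨f y, hy⟩ : S)
  set Q : LocalizedModule S N →ₗ[A] A × (Fin k → M) :=
    (ε.toLinearMap ∘ₗ LocalizedModule.map S q).prod q'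
  set P : (A × (Fin k → M)) →ₗ[A] LocalizedModule S N :=
    (τ⁻¹.val : A) • (LocalizedModule.map S p ∘ₗ ε.symm.toLinearMap).coprod p'
  have hPQ : P ∘ₗ Q = LinearMap.id := by
    have h1 : (LocalizedModule.map S p) ∘ₗ (LocalizedModule.map S q) + p' ∘ₗ q' =
        (τ : A) • LinearMap.id := by
      have h2 := LocalizedModule.map_smul_one S N t
      rw [h, map_add, ← hpq] at h2
      rw [hτ, ← Module.End.one_eq_id, ← h2]
      congr 1
      refine LinearMap.ext fun x ↦ ?_
      induction x using LocalizedModule.induction_on with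
      | h n s => simp [LocalizedModule.map_mk]
    refine LinearMap.ext fun x ↦ ?_
    have h3 := LinearMap.congr_fun h1 x
    simp only [LinearMap.add_apply, LinearMap.comp_apply, LinearMap.smul_apply,
      LinearMap.id_apply] at h3
    simp [P, Q, h3, ← mul_smul]
  obtain ⟨E⟩ := nonempty_prod_ker_equiv Q P hPQ
  obtain ⟨c, hc⟩ := exists_finrank_eq_one_add_mul E
    (y := LocalizedModule.mk y 1)
    (f := (σ⁻¹.val : A) • (ε.toLinearMap ∘ₗ LocalizedModule.map S f)) (by
      have : ε (LocalizedModule.mk (f y) 1) = algebraMap R A (f y) :=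
        IsLocalizedModule.iso_mk_one S (Algebra.linearMap R A) (f y)
      have h4 : LocalizedModule.map S f (LocalizedModule.mk y 1) = LocalizedModule.mk (f y) 1 :=
        LocalizedModule.map_mk S f y 1
      simp [h4, this, ← hσ])
  exact ⟨c, by rw [← hc, finrank_localizedModule S fun h ↦ h m.zero_mem]⟩

open Classical in
/-- If `f x` lies outside an ideal, then so does the value of `f` at some component of `x`. -/
theorem DirectSum.IsInternal.exists_component_notMem {L : Type*} [AddCommGroup L] [Module R L]
    {ι : Type*} {N : ι → Submodule R L} (hN : DirectSum.IsInternal N) (m : Ideal R)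
    (f : L →ₗ[R] R) {x : L} (hx : f x ∉ m) :
    ∃ (i : ι) (π : L →ₗ[R] N i), π ∘ₗ (N i).subtype = LinearMap.id ∧ f (π x) ∉ m := by
  set e := LinearEquiv.ofBijective (DirectSum.coeLinearMap N) hN
  by_contra! h
  have h : ∀ i, f (e.symm x i) ∈ m := fun i ↦
    h i (DirectSum.component R ι (fun i ↦ N i) i ∘ₗ e.symm.toLinearMap) <|
      LinearMap.ext fun y ↦ hN.ofBijective_coeLinearMap_same y
  refine hx ?_
  have hsum : x = ∑ i ∈ (e.symm x).support, (e.symm x i : L) := by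
    conv_lhs => rw [← e.apply_symm_apply x, ← DirectSum.sum_support_of (e.symm x), map_sum]
    exact Finset.sum_congr rfl fun i _ ↦ DirectSum.coeLinearMap_of N i _
  rw [hsum, map_sum]
  exact Ideal.sum_mem m fun i _ ↦ h i

end Summands

/-! ### The counterexample module -/

section Counterexample

variable {R : Type u} [CommRing R]

theorem moduleRank_ne_zero {A : Type u} [CommRing A] [IsDomain A] {M : Type v} [AddCommGroup M]
    [Module A M] [Module.Finite A M] [Module.IsTorsionFree A M] [Nontrivial M] :
    moduleRank A M ≠ 0 := by
  rw [moduleRank_eq_finrank]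
  exact Module.finrank_pos.ne'

/-- If `m₁` is the only maximal ideal that can contain `I`, and `m₂ ≠ m₁` the only one that can
contain `J`, then `I` and `J` are comaximal. -/
theorem exists_add_eq_one_of_forall_isMaximal {m₁ m₂ : Ideal R} (hm : m₁ ≠ m₂) {I J : Ideal R}
    (hI : ∀ n : Ideal R, n.IsMaximal → n ≠ m₁ → ∃ t ∉ n, t ∈ I)
    (hJ : ∀ n : Ideal R, n.IsMaximal → n ≠ m₂ → ∃ t ∉ n, t ∈ J) : ∃ a ∈ I, ∃ b ∈ J, a + b = 1 := by
  rw [← Ideal.isCoprime_iff_exists, Ideal.isCoprime_iff_sup_eq]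
  by_contra h
  obtain ⟨n, hn, hle⟩ := Ideal.exists_le_maximal _ h
  rw [sup_le_iff] at hle
  by_cases hnm : n = m₁
  · obtain ⟨t, ht, htJ⟩ := hJ n hn (hnm.trans_ne hm)
    exact ht (hle.2 htJ)
  · obtain ⟨t, ht, htI⟩ := hI n hn hnm
    exact ht (hle.1 htI)

/-- The amalgam `L` of `R ⊕ Y ^ (ℕ)` and `Z ^ (ℕ)`, for lattices `Y` and `Z` that are global forms
of `M₁` and `M₂`, is not a direct sum of finitely generated modules. A finitely generated summand
of `L` has rank divisible by the rank of `M₂`, by localization at `m₂`. The summand that contains,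
locally at `m₁`, the summand `R` of `L` has rank `1` modulo the rank of `M₁`. -/
theorem IsHLocalDomain.exists_memAdd_not_isDirectSumOfFG (hR : IsHLocalDomain R)
    (m₁ m₂ : Ideal R) [m₁.IsMaximal] [m₂.IsMaximal] (hm : m₁ ≠ m₂)
    (M₁ : Type v) [AddCommGroup M₁] [Module (Localization.AtPrime m₁) M₁]
    (M₂ : Type w) [AddCommGroup M₂] [Module (Localization.AtPrime m₂) M₂]
    [Module.Finite (Localization.AtPrime m₁) M₁] [Module.Finite (Localization.AtPrime m₂) M₂]
    (hind₁ : IsIndecomposableModule (Localization.AtPrime m₁) M₁)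
    (hind₂ : IsIndecomposableModule (Localization.AtPrime m₂) M₂)
    [Module.IsTorsionFree (Localization.AtPrime m₁) M₁]
    [Module.IsTorsionFree (Localization.AtPrime m₂) M₂]
    [IsLocalRing (Module.End (Localization.AtPrime m₁) M₁)]
    [IsLocalRing (Module.End (Localization.AtPrime m₂) M₂)]
    (hcop : ¬ Nat.Coprime (moduleRank (Localization.AtPrime m₁) M₁)
      (moduleRank (Localization.AtPrime m₂) M₂))
    {X₁ : Type u} [AddCommGroup X₁] [Module R X₁] {X₂ : Type u} [AddCommGroup X₂] [Module R X₂]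
    (h₁ : IsGlobalForm R m₁ M₁ X₁) (h₂ : IsGlobalForm R m₂ M₂ X₂) :
    ∃ (L : Type u) (_ : AddCommGroup L) (_ : Module R L),
      MemAdd R (X₁ × X₂) L ∧ ¬ IsDirectSumOfFG R L := by
  classical
  have := hR.isDomain
  have := hind₁.nontrivial
  have := hind₂.nontrivial
  have hr₁ := moduleRank_ne_zero (A := Localization.AtPrime m₁) (M := M₁)
  have hr₂ := moduleRank_ne_zero (A := Localization.AtPrime m₂) (M := M₂)
  -- global forms `Y` and `Z` that are lattices, with respect to the same scalar `s`
  obtain ⟨s₁, hs₁, hY⟩ := hR.exists_submodule_pi m₁ M₁ rfl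
  obtain ⟨s₂, hs₂, hZ⟩ := hR.exists_submodule_pi m₂ M₂ rfl
  have hs := mul_ne_zero hs₁ hs₂
  obtain ⟨Y, hYfg, hsY, hYM, htY⟩ := hY _ hs (dvd_mul_right s₁ s₂)
  obtain ⟨Z, hZfg, hsZ, hZM, htZ⟩ := hZ _ hs (dvd_mul_left s₂ s₁)
  have hYX := (hR.isGlobalForm m₁ M₁ hind₁ rfl hs hYfg hsY hYM htY).one_mem_factoringEnd h₁
  have hZX := (hR.isGlobalForm m₂ M₂ hind₂ rfl hs hZfg hsZ hZM htZ).one_mem_factoringEnd h₂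
  have hRX := one_mem_factoringEnd_self_prod hm hr₁ hr₂ h₁ h₂
  obtain ⟨L, _, _, α, β, hα, hβ⟩ := exists_amalgam hr₁ hr₂ hs Y Z hsY hsZ
  refine ⟨L, inferInstance, inferInstance, ?_, ?_⟩
  · -- the conductors of the two lattices are comaximal, so `L` splits off `(R ⊕ Y ^ (ℕ)) ⊕ Z ^ (ℕ)`
    obtain ⟨a, ha, b, hb, hab⟩ := exists_add_eq_one_of_forall_isMaximal hm
      (I := (LinearMap.range (LinearMap.lsmul R _ (s₁ * s₂))).colon (Y : Set _))
      (J := (LinearMap.range (LinearMap.lsmul R _ (s₁ * s₂))).colon (Z : Set _))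
      (fun n hn hnm ↦ (htY n hn hnm).imp fun t ht ↦ ⟨ht.1, Submodule.mem_colon.mpr
        fun y hy ↦ (ht.2 y hy).imp fun _ h ↦ h.symm⟩)
      (fun n hn hnm ↦ (htZ n hn hnm).imp fun t ht ↦ ⟨ht.1, Submodule.mem_colon.mpr
        fun y hy ↦ (ht.2 y hy).imp fun _ h ↦ h.symm⟩)
    obtain ⟨κ, hκ, -⟩ := hα b fun z hz ↦ (Submodule.mem_colon.mp hb z hz).imp fun _ h ↦ h.symm
    obtain ⟨l, hl⟩ := hβ a fun y hy ↦ (Submodule.mem_colon.mp ha y hy).imp fun _ h ↦ h.symm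
    have hP : MemAdd R (X₁ × X₂) ((R × (ℕ →₀ Y)) × (ℕ →₀ Z)) :=
      ((MemAdd.of_one_mem_factoringEnd hRX).prod
        ((MemAdd.of_one_mem_factoringEnd (factoringEnd_le_of_comp_eq_id (LinearMap.inl R X₁ X₂)
          (LinearMap.fst R X₁ X₂) (LinearMap.fst_comp_inl ..) hYX)).finsupp ℕ)).prod
      ((MemAdd.of_one_mem_factoringEnd (factoringEnd_le_of_comp_eq_id (LinearMap.inr R X₁ X₂)
          (LinearMap.snd R X₁ X₂) (LinearMap.snd_comp_inr ..) hZX)).finsupp ℕ)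
    refine hP.of_comp_eq_id (κ.prod l) (α.coprod β) ?_
    rw [LinearMap.coprod_comp_prod, hκ, hl, ← add_smul, add_comm b a, hab, one_smul]
  · rintro ⟨ι, N, hN, hint⟩
    obtain ⟨t₁, ht₁, hZt₁⟩ := htZ m₁ ‹_› hm
    obtain ⟨t₂, ht₂, hYt₂⟩ := htY m₂ ‹_› hm.symm
    obtain ⟨κ, hακ, hκα⟩ := hα t₁ hZt₁
    obtain ⟨l, hβl⟩ := hβ t₂ hYt₂
    -- `(1, 0)` and `κ` exhibit `R` as a direct summand of `L`, hence of some `N i`, locally at `m₁`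
    obtain ⟨i, π, hπ, hi⟩ := hint.exists_component_notMem m₁ (LinearMap.fst R R (ℕ →₀ Y) ∘ₗ κ)
      (x := α (1, 0)) (by
        have := LinearMap.congr_fun hκα (1, 0)
        rw [LinearMap.comp_apply] at this
        simpa [this] using ht₁)
    have hfin : Module.Finite R (N i) := Module.Finite.iff_fg.mpr (hN i)
    have hfactor : ∀ {K : Type u} [AddCommGroup K] [Module R K] {t : R} (p : K →ₗ[R] L)
        (q : L →ₗ[R] K), p ∘ₗ q = t • LinearMap.id →
        (π ∘ₗ p) ∘ₗ (q ∘ₗ (N i).subtype) = t • (1 : Module.End R (N i)) := fun {K _ _ t} p q h ↦ by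
      refine LinearMap.ext fun x ↦ ?_
      have h1 : p (q x) = t • (x : L) := LinearMap.congr_fun h x
      have h2 : π x = x := LinearMap.congr_fun hπ x
      simp [h1, h2]
    obtain ⟨e₁⟩ := hYM
    obtain ⟨e₂⟩ := hZM
    have hdvd : Module.finrank (Localization.AtPrime m₂) M₂ ∣ Module.finrank R (N i) := by
      refine finrank_dvd_of_smul_one_mem_factoringEnd m₂.primeCompl (fun h ↦ h m₂.zero_mem) e₂
        ht₂ ?_
      rw [← hfactor (K := ℕ →₀ Z) β l hβl]
      exact comp_finsupp_mem_factoringEnd _ _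
    obtain ⟨c, hc⟩ := exists_finrank_eq_one_add_mul_of_localized m₁ e₁ ht₁
      (LinearMap.fst R R (ℕ →₀ Y) ∘ₗ κ ∘ₗ (N i).subtype) (π ∘ₗ α ∘ₗ LinearMap.inl R R (ℕ →₀ Y))
      (comp_finsupp_mem_factoringEnd (LinearMap.snd R R (ℕ →₀ Y) ∘ₗ κ ∘ₗ (N i).subtype)
        (π ∘ₗ α ∘ₗ LinearMap.inr R R (ℕ →₀ Y)))
      (by
        rw [← hfactor (K := R × (ℕ →₀ Y)) α κ hακ]
        refine LinearMap.ext fun x ↦ ?_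
        simp [← map_add])
      (y := π (α (1, 0))) (f := LinearMap.fst R R (ℕ →₀ Y) ∘ₗ κ ∘ₗ (N i).subtype) hi
    rw [moduleRank_eq_finrank, moduleRank_eq_finrank] at hcop
    refine hcop (Nat.Coprime.coprime_dvd_right hdvd ?_)
    rw [hc]
    simp

end Counterexample

theorem mainTheorem9 {R : Type u} [CommRing R] (hR : IsHLocalDomain R)
    (m₁ m₂ : Ideal R) [m₁.IsMaximal] [m₂.IsMaximal] (hm : m₁ ≠ m₂)
    (M₁ : Type v) [AddCommGroup M₁] [Module (Localization.AtPrime m₁) M₁]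
    (M₂ : Type w) [AddCommGroup M₂] [Module (Localization.AtPrime m₂) M₂]
    (hfin₁ : Module.Finite (Localization.AtPrime m₁) M₁)
    (hfin₂ : Module.Finite (Localization.AtPrime m₂) M₂)
    (hind₁ : IsIndecomposableModule (Localization.AtPrime m₁) M₁)
    (hind₂ : IsIndecomposableModule (Localization.AtPrime m₂) M₂)
    (htf₁ : Module.IsTorsionFree (Localization.AtPrime m₁) M₁)
    (htf₂ : Module.IsTorsionFree (Localization.AtPrime m₂) M₂)
    (hloc₁ : IsLocalRing (Module.End (Localization.AtPrime m₁) M₁))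
    (hloc₂ : IsLocalRing (Module.End (Localization.AtPrime m₂) M₂)) :
    (∃ (X₁ : Type u) (_ : AddCommGroup X₁) (_ : Module R X₁), IsGlobalForm R m₁ M₁ X₁) ∧
    (∃ (X₂ : Type u) (_ : AddCommGroup X₂) (_ : Module R X₂), IsGlobalForm R m₂ M₂ X₂) ∧
    (¬ Nat.Coprime (moduleRank (Localization.AtPrime m₁) M₁)
        (moduleRank (Localization.AtPrime m₂) M₂) →
      ∀ (X₁ : Type u) [AddCommGroup X₁] [Module R X₁]
        (X₂ : Type u) [AddCommGroup X₂] [Module R X₂],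
        IsGlobalForm R m₁ M₁ X₁ → IsGlobalForm R m₂ M₂ X₂ →
        ∃ (L : Type u) (_ : AddCommGroup L) (_ : Module R L),
          MemAdd R (X₁ × X₂) L ∧ ¬ IsDirectSumOfFG R L) := by
  exact ⟨hR.exists_isGlobalForm m₁ M₁ hind₁, hR.exists_isGlobalForm m₂ M₂ hind₂,
    fun hcop _ _ _ _ _ _ h₁ h₂ ↦
      hR.exists_memAdd_not_isDirectSumOfFG m₁ m₂ hm M₁ M₂ hind₁ hind₂ hcop h₁ h₂⟩
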